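/- Conventions. Let $x(y)=-e^{-y}$ (relativistic black hole) or $x(y)=-\log(1+e^{-y})$ (CGHS black hole), with all model parameters normalized ($M=\lambda=1$, $\Delta=x_o^+=0$). Let $\phi(x)=\frac1{\sqrt{2\pi}}\int_0^\infty\frac{dk}{2k}\,[a(k)e^{-ikx}+a^\dagger(k)e^{ikx}]$, $[a(k),a^\dagger(k')]=2k\,\delta(k-k')$, be the (right-moving) real massless scalar field on the bosonic Fock space over $L^2(\frac{dk}{2k},\mathbb R_+)$ with vacuum $\Omega_o$; put $\phi[h]=\int h(x)\phi(x)\,dx$, $\hat\phi[f]=\int f(y)\,\phi(x(y))\,dy$ and $\Omega_g=\phi[g]^\dagger\Omega_o$. The mean numbers of particles with wave function $f$ in the incoming vacuum and in the incoming one-particle state $\Omega_g$ are $\bar N_o[f]=\|\hat\phi[f]\,\Omega_o\|^2$ and $\bar N_g[f]=\|\hat\phi[f]\,\Omega_g\|^2$, both in $[0,\infty]$. A normalized wave function is an integrable $f:\mathbb R\to\mathbb C$ whose Fourier transform $\tilde f(p)=\frac1{\sqrt{2\pi}}\int e^{-ipy}f(y)\,dy$ vanishes for $p<0$ and satisfies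 $\int_0^\infty\frac{dp}{2p}|\tilde f(p)|^2=1$. Put $f_{y_o}(y)=f(y-y_o)$. Since both mean numbers may be infinite, "$\bar N_g[f]-\bar N_o[f]=d$" means that $\bar N_g[f]=\bar N_o[f]+d$ in the extended reals and that $d$ is the limit, as $\varepsilon\to0^+$, of the differences of the (finite) mean numbers obtained by keeping only the modes $\varepsilon\le k\le1/\varepsilon$ in $\hat\phi[f]$. Theorem. Let $f$ and $g$ be normalized wave functions. Suppose there are constants $\alpha>0$, $C>0$ and $L\ge0$ such that $$|f(y)|\le\frac{C}{|y|^{1+\alpha}}\qquad\text{for a.e. }y\le-L .$$ Then, for both models, the real number $\bar N_g[f_{y_o}]-\bar N_o[f_{y_o}]$ exists for every $y_o\in\mathbb R$, and: (i) if $g$ has a left limit $g(0^-)$ at $0$, then for all sufficiently large $y_o$ (depending on the data) $$\bigl|\bar N_g[f_{y_o}]-\bar N_o[f_{y_o}]\bigr|\le\|g\|_{L^1(\mathbb R_-)}^2\,\frac{4C^2}{\alpha^2\bigl(\tfrac12y_o+L\bigr)^{2\alpha}}+e^{2L-y_o}\,\|f\|_{L^1(\mathbb R)}^2\,|g(0^-)|^2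 ;$$ (ii) $\displaystyle\lim_{y_o\to+\infty}\bigl(\bar N_g[f_{y_o}]-\bar N_o[f_{y_o}]\bigr)=0$. -/

import Mathlib

open MeasureTheory Filter Topology Set
open scoped ENNReal

noncomputable section

namespace BlackHole

/-- Coordinate change `x(y)` of the relativistic black hole (unit mass, horizon at `x = 0`). -/
def relativisticCoord (y : ℝ) : ℝ := -Real.exp (-y)

/-- Coordinate change `x(y)` of the CGHS black hole (unit parameters, horizon at `x = 0`). -/
def cghsCoord (y : ℝ) : ℝ := -Real.log (1 + Real.exp (-y))

/-- The measure `dk / (2k)` on the half-line `k > 0`, as a measure on `ℝ`. -/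
def momentumMeasure : Measure ℝ :=
  (volume.restrict (Ioi 0)).withDensity fun k => ENNReal.ofReal (1 / (2 * k))

/-- `k ↦ (2π)^(-1/2) ∫ dy e^{-i k X(y)} f(y)`. For `X = id` this is the Fourier transform of `f`.
For the coordinate change `X = x(y)` it is the Fourier transform in `x` of the incoming test
function `f(y(x)) |dy/dx|` carried from the outgoing test function `f`. -/
def momentumTransform (X : ℝ → ℝ) (f : ℝ → ℂ) (k : ℝ) : ℂ :=
  ((Real.sqrt (2 * Real.pi))⁻¹ : ℝ) * ∫ y, Complex.exp (-(Complex.I * (k : ℂ) * (X y : ℂ))) * f y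

/-- An integrable function whose Fourier transform is supported in `[0, ∞)` and has norm one
in `L²(dk/2k, ℝ₊)`. -/
structure IsNormalizedWaveFunction (f : ℝ → ℂ) : Prop where
  integrable : Integrable f
  positive_momentum : ∀ k < 0, momentumTransform id f k = 0
  normalized : ∫⁻ k, ‖momentumTransform id f k‖ₑ ^ 2 ∂momentumMeasure = 1

/-! ### Bosonic Fock space over `L²(dk/2k, ℝ₊)`, in the momentum representation -/

/-- A sequence of `n`-particle wave functions. The vectors of the Fock space are the symmetric
ones whose `normSq` below is finite. -/
abbrev FockVector : Type := (n : ℕ) → (Fin n → ℝ) → ℂ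

/-- The squared Fock norm; it is infinite for a sequence outside the Fock space. -/
def normSq (ψ : FockVector) : ℝ≥0∞ :=
  ∑' n : ℕ, ∫⁻ k, ‖ψ n k‖ₑ ^ 2 ∂(Measure.pi fun _ : Fin n => momentumMeasure)

/-- The incoming vacuum. -/
def vacuum : FockVector
  | 0 => fun _ => 1
  | _ + 1 => fun _ => 0

/-- The operator `∫ dk/(2k) h(k) a(k)`. -/
def annihilate (h : ℝ → ℂ) (ψ : FockVector) : FockVector := fun n k =>
  (Real.sqrt (n + 1) : ℂ) * ∫ q, h q * ψ (n + 1) (Fin.cons q k) ∂momentumMeasure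

/-- The operator `∫ dk/(2k) h(k) a†(k)`. -/
def create (h : ℝ → ℂ) (ψ : FockVector) : FockVector
  | 0 => fun _ => 0
  | n + 1 => fun k =>
      ((Real.sqrt (n + 1))⁻¹ : ℂ) * ∑ i : Fin (n + 1), h (k i) * ψ n fun j => k (i.succAbove j)

/-- The operator `∫₀^∞ dk/(2k) [H(k) a(k) + H(-k) a†(k)]`: the real scalar field
`φ(x) = (2π)^(-1/2) ∫₀^∞ dk/(2k) [a(k) e^{-ikx} + a†(k) e^{ikx}]` smeared with the (complex) test
function whose Fourier transform is `H`. -/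
def smear (H : ℝ → ℂ) (ψ : FockVector) : FockVector :=
  annihilate H ψ + create (fun k => H (-k)) ψ

/-- The incoming field `φ[h] = ∫ dx h(x) φ(x)`. -/
def inField (h : ℝ → ℂ) : FockVector → FockVector := smear (momentumTransform id h)

/-- The outgoing field `φ̂[f] = ∫ dy f(y) φ(x(y))`. -/
def outField (X : ℝ → ℝ) (f : ℝ → ℂ) : FockVector → FockVector := smear (momentumTransform X f)

/-- The outgoing field restricted to the incoming modes `ε ≤ |k| ≤ 1/ε`. -/
def outFieldCutoff (ε : ℝ) (X : ℝ → ℝ) (f : ℝ → ℂ) : FockVector → FockVector :=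
  smear ({k : ℝ | ε ≤ |k| ∧ |k| ≤ 1 / ε}.indicator (momentumTransform X f))

/-- The one-particle state `Ω_g = φ[g]† Ω₀ = φ[g*] Ω₀`. -/
def oneParticleState (g : ℝ → ℂ) : FockVector :=
  inField (fun x => starRingEnd ℂ (g x)) vacuum

/-- The mean number `(ψ, φ̂[f]† φ̂[f] ψ) = ‖φ̂[f] ψ‖²` of outgoing particles with wave function `f`
in the incoming state `ψ`, with values in `[0, ∞]`. -/
def meanNumber (X : ℝ → ℝ) (ψ : FockVector) (f : ℝ → ℂ) : ℝ≥0∞ := normSq (outField X f ψ)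

/-- The contribution of the incoming modes `ε ≤ |k| ≤ 1/ε` to the mean number of particles. For
integrable `f` it is finite in the vacuum and in the normalized one-particle states. -/
def meanNumberCutoff (ε : ℝ) (X : ℝ → ℝ) (ψ : FockVector) (f : ℝ → ℂ) : ℝ≥0∞ :=
  normSq (outFieldCutoff ε X f ψ)

/-- The real number `d` is the difference `N̄_g[f] - N̄₀[f]`. As both mean numbers may be infinite,
this is required in the form `N̄_g[f] = N̄₀[f] + d` in the extended reals, together with the
convergence to `d` of the differences of the (finite) mean numbers with cutoff. -/
def IsNumberDifference (X : ℝ → ℝ) (g f : ℝ → ℂ) (d : ℝ) : Prop :=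
  (meanNumber X (oneParticleState g) f : EReal) = (meanNumber X vacuum f : EReal) + (d : EReal) ∧
  Tendsto
    (fun ε : ℝ => (meanNumberCutoff ε X (oneParticleState g) f).toReal -
      (meanNumberCutoff ε X vacuum f).toReal)
    (𝓝[>] 0) (𝓝 d)

/-- The translate `f_{y₀}(y) = f(y - y₀)`. -/
def translate (y₀ : ℝ) (f : ℝ → ℂ) (y : ℝ) : ℂ := f (y - y₀)

end BlackHole

end

/-! On the vacuum the field creates one particle; on the normalized state `Ω_g` it gives a
zero-particle and a symmetrized two-particle component. Expanding the symmetrized square, the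
diagonal part reproduces the vacuum mean number, so the difference is the sum of the squared moduli
of two overlaps of the transform of `f` with that of `g` (`normSq_smear_smear_vacuum_of_memLp`). If
the vacuum number is infinite, so is the other, and the cutoff differences determine `d`.

Since `g` has only positive momenta, each overlap equals an integral antisymmetrized in `k`. By
Fubini its kernel is the integral of `sin (k D) / (2k)` with `D = X y - x`: a difference of sine
integrals, bounded uniformly in the cutoff and converging to a multiple of `sign D`
(`tendsto_setIntegral_cutoffModes_antisymm`).

The Fourier transform of `f` is continuous and vanishes at negative momenta, so `∫ f = 0`. This
removes the part of the sign kernel independent of `y`, and the amplitude becomes a constant times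
`∫ f(y) ∫_{X(y)}^0 g(x) dx dy` (`amplitude_eq`). Translating `f` to late times shrinks the inner
interval to the horizon, and dominated convergence gives (ii). For (i), the integral is split at `y
= -(y₀/2 + L)`: the decay of `f` controls the past, and the rest is exponentially small. -/

namespace BlackHole

/-! ### The sine integral -/

/-- The sine integral `Si`. -/
noncomputable def sineIntegral (T : ℝ) : ℝ := ∫ t in (0 : ℝ)..T, Real.sinc t

theorem sineIntegral_neg (T : ℝ) : sineIntegral (-T) = -sineIntegral T := by
  have h := intervalIntegral.integral_comp_neg (a := 0) (b := T) Real.sinc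
  simp only [Real.sinc_neg, neg_zero] at h
  rw [sineIntegral, sineIntegral, h, intervalIntegral.integral_symm]

theorem continuous_sineIntegral : Continuous sineIntegral :=
  intervalIntegral.continuous_primitive (fun _ _ => Real.continuous_sinc.intervalIntegrable _ _) 0

theorem sineIntegral_zero : sineIntegral 0 = 0 := by simp [sineIntegral]

theorem continuousOn_cos_div_sq : ContinuousOn (fun t : ℝ => Real.cos t / t ^ 2) (Ioi 0) :=
  Real.continuous_cos.continuousOn.div (by fun_prop) fun t ht => pow_ne_zero 2 (ne_of_gt ht)

/-- Integration by parts trades the conditionally convergent tail for an absolutely convergent one;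
both the uniform bound and the limit are read off from it. -/
theorem sineIntegral_eq {T : ℝ} (hT : 1 ≤ T) :
    sineIntegral T =
      sineIntegral 1 + (Real.cos 1 - Real.cos T / T - ∫ t in (1 : ℝ)..T, Real.cos t / t ^ 2) := by
  have hsub : uIcc 1 T ⊆ Ioi (0 : ℝ) := by
    rw [uIcc_of_le hT]; exact fun t ht => lt_of_lt_of_le one_pos ht.1
  have hci : IntervalIntegrable (fun t : ℝ => Real.cos t / t ^ 2) volume 1 T :=
    (continuousOn_cos_div_sq.mono hsub).intervalIntegrable
  have hs : IntervalIntegrable Real.sinc volume 1 T := Real.continuous_sinc.intervalIntegrable _ _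
  have key : ∫ t in (1 : ℝ)..T, (Real.sinc t + Real.cos t / t ^ 2)
      = -Real.cos T / T - -Real.cos 1 / 1 := by
    refine intervalIntegral.integral_eq_sub_of_hasDerivAt
      (f := fun t : ℝ => -Real.cos t / t) (fun t ht => ?_) (hs.add hci)
    have ht0 : t ≠ 0 := ne_of_gt (hsub ht)
    have h := (Real.hasDerivAt_cos t).neg.div (hasDerivAt_id t) ht0
    refine h.congr_deriv ?_
    rw [Real.sinc_of_ne_zero ht0]
    simp only [id, Pi.neg_apply]
    field_simp
    ring
  rw [intervalIntegral.integral_add hs hci] at key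
  have hadd : sineIntegral T = sineIntegral 1 + ∫ t in (1 : ℝ)..T, Real.sinc t :=
    (intervalIntegral.integral_add_adjacent_intervals
      (Real.continuous_sinc.intervalIntegrable _ _) hs).symm
  rw [hadd]
  linear_combination key

theorem norm_cos_div_sq_le (t : ℝ) : ‖Real.cos t / t ^ 2‖ ≤ t ^ (-2 : ℤ) := by
  rw [norm_div, Real.norm_eq_abs, norm_pow, Real.norm_eq_abs, sq_abs, zpow_neg, ← one_div]
  exact div_le_div_of_nonneg_right (Real.abs_cos_le_one t) (sq_nonneg t)

theorem abs_sineIntegral_le_of_le_one {T : ℝ} (h0 : 0 ≤ T) (h1 : T ≤ 1) : |sineIntegral T| ≤ 1 := by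
  have h := intervalIntegral.norm_integral_le_of_norm_le_const (a := 0) (b := T) (f := Real.sinc)
    (C := 1) fun t _ => Real.abs_sinc_le_one t
  rw [Real.norm_eq_abs, sub_zero, one_mul, abs_of_nonneg h0] at h
  exact h.trans h1

/-- For `T ≥ 1` the bound is `1` from `[0, 1]`, `1` from `cos 1`, and `1/T + (1 - 1/T)` from the
last two terms of `sineIntegral_eq`. -/
theorem abs_sineIntegral_le (T : ℝ) : |sineIntegral T| ≤ 3 := by
  wlog h0 : 0 ≤ T with H
  · rw [← abs_neg, ← sineIntegral_neg]
    exact H (-T) (by linarith)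
  rcases le_total T 1 with h1 | h1
  · linarith [abs_sineIntegral_le_of_le_one h0 h1]
  have hT : 0 < T := by linarith
  have hI : |∫ t in (1 : ℝ)..T, Real.cos t / t ^ 2| ≤ 1 - T⁻¹ := by
    have h := intervalIntegral.norm_integral_le_of_norm_le (μ := volume) h1
      (Eventually.of_forall fun t _ => norm_cos_div_sq_le t)
      (intervalIntegral.intervalIntegrable_zpow (Or.inr (by rw [uIcc_of_le h1]; simp)))
    rw [integral_zpow (Or.inr ⟨by norm_num, by rw [uIcc_of_le h1]; simp⟩)] at h
    rw [← Real.norm_eq_abs]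
    refine h.trans (le_of_eq ?_)
    norm_num
    ring
  have hc : |Real.cos T / T| ≤ T⁻¹ := by
    rw [abs_div, abs_of_pos hT, ← one_div]
    exact div_le_div_of_nonneg_right (Real.abs_cos_le_one T) hT.le
  have h2 := abs_sineIntegral_le_of_le_one zero_le_one le_rfl
  have h3 := Real.abs_cos_le_one 1
  rw [sineIntegral_eq h1]
  rw [abs_le] at *
  constructor <;> linarith

/-- The exact value `π/2` is not needed: a bound below `π` suffices in
`norm_amplitude_translate_le`. -/
theorem exists_tendsto_sineIntegral : ∃ σ : ℝ, |σ| ≤ 3 ∧ Tendsto sineIntegral atTop (𝓝 σ) := by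
  have hint : IntegrableOn (fun t : ℝ => Real.cos t / t ^ 2) (Ioi 1) := by
    have h : IntegrableOn (fun t : ℝ => t ^ (-2 : ℤ)) (Ioi 1) := by
      have h := integrableOn_Ioi_rpow_of_lt (a := ((-2 : ℤ) : ℝ)) (by norm_num) one_pos
      simpa only [Real.rpow_intCast] using h
    refine Integrable.mono' h ?_ (Eventually.of_forall norm_cos_div_sq_le)
    exact (continuousOn_cos_div_sq.mono (Ioi_subset_Ioi zero_le_one)).aestronglyMeasurable
      measurableSet_Ioi
  have h1 := intervalIntegral_tendsto_integral_Ioi 1 hint tendsto_id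
  have h2 : Tendsto (fun T : ℝ => Real.cos T / T) atTop (𝓝 0) := by
    refine squeeze_zero_norm' (a := fun T : ℝ => T⁻¹) ?_ tendsto_inv_atTop_zero
    filter_upwards [eventually_gt_atTop 0] with T hT
    rw [norm_div, Real.norm_eq_abs, Real.norm_of_nonneg hT.le, ← one_div]
    exact div_le_div_of_nonneg_right (Real.abs_cos_le_one T) hT.le
  have h3 := (((tendsto_const_nhds (x := Real.cos 1)).sub h2).sub h1).const_add (sineIntegral 1)
  refine ⟨_, ?_, h3.congr' ?_⟩
  rotate_left
  · filter_upwards [eventually_ge_atTop 1] with T hT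
    exact (sineIntegral_eq hT).symm
  · refine le_of_tendsto (h3.abs) ?_
    filter_upwards [eventually_ge_atTop 1] with T hT
    have := abs_sineIntegral_le T
    rwa [sineIntegral_eq hT] at this

/-- The limit of the sine integral at infinity. -/
noncomputable def sineIntegralLimit : ℝ := exists_tendsto_sineIntegral.choose

theorem abs_sineIntegralLimit_le : |sineIntegralLimit| ≤ 3 :=
  exists_tendsto_sineIntegral.choose_spec.1

theorem tendsto_sineIntegral : Tendsto sineIntegral atTop (𝓝 sineIntegralLimit) :=
  exists_tendsto_sineIntegral.choose_spec.2

theorem tendsto_sineIntegral_div (D : ℝ) :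
    Tendsto (fun ε : ℝ => sineIntegral (D / ε) - sineIntegral (ε * D)) (𝓝[>] 0)
      (𝓝 (sineIntegralLimit * Real.sign D)) := by
  have h0 : Tendsto (fun ε : ℝ => sineIntegral (ε * D)) (𝓝[>] 0) (𝓝 0) := by
    have h : Continuous fun ε : ℝ => sineIntegral (ε * D) :=
      continuous_sineIntegral.comp (by fun_prop)
    have := h.tendsto 0
    simp only [zero_mul, sineIntegral_zero] at this
    exact this.mono_left nhdsWithin_le_nhds
  have hpos : ∀ D : ℝ, 0 < D →
      Tendsto (fun ε : ℝ => sineIntegral (D / ε)) (𝓝[>] 0) (𝓝 sineIntegralLimit) := fun D hD =>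
    tendsto_sineIntegral.comp (tendsto_inv_nhdsGT_zero.const_mul_atTop hD)
  rcases lt_trichotomy D 0 with hD | rfl | hD
  · have h := (hpos (-D) (by linarith)).neg.sub h0
    simpa [Real.sign_of_neg hD, neg_div, sineIntegral_neg] using h
  · simp [sineIntegral_zero]
  · simpa [Real.sign_of_pos hD] using (hpos D hD).sub h0

theorem integral_sin_mul_div {ε : ℝ} (hε : 0 < ε) (hε1 : ε ≤ 1) (D : ℝ) :
    ∫ k in ε..1 / ε, 1 / (2 * k) * Real.sin (k * D) =
      (sineIntegral (D / ε) - sineIntegral (ε * D)) / 2 := by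
  have hle : ε ≤ 1 / ε := by rw [le_div_iff₀ hε]; nlinarith
  have hcongr : ∫ k in ε..1 / ε, 1 / (2 * k) * Real.sin (k * D)
      = ∫ k in ε..1 / ε, D / 2 * Real.sinc (k * D) := by
    refine intervalIntegral.integral_congr fun k hk => ?_
    rw [uIcc_of_le hle] at hk
    have hk0 : k ≠ 0 := (hε.trans_le hk.1).ne'
    rcases eq_or_ne D 0 with rfl | hD
    · simp
    · simp only [Real.sinc_of_ne_zero (mul_ne_zero hk0 hD)]
      field_simp
  rw [hcongr, intervalIntegral.integral_const_mul]
  have h := intervalIntegral.mul_integral_comp_mul_right (f := Real.sinc) (a := ε) (b := 1 / ε) D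
  have h2 : sineIntegral (D / ε) - sineIntegral (ε * D) = ∫ t in ε * D..1 / ε * D, Real.sinc t := by
    rw [sineIntegral, sineIntegral, intervalIntegral.integral_interval_sub_left
      (Real.continuous_sinc.intervalIntegrable _ _) (Real.continuous_sinc.intervalIntegrable _ _)]
    congr 1; ring
  rw [h2, ← h]; ring

/-! ### The momentum measure -/

theorem measurable_momentumDensity : Measurable fun k : ℝ => ENNReal.ofReal (1 / (2 * k)) := by
  fun_prop

instance : SigmaFinite momentumMeasure := by
  unfold momentumMeasure
  exact SigmaFinite.withDensity_of_ne_top (Eventually.of_forall fun _ => ENNReal.ofReal_ne_top)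

/-- The modes `ε ≤ |k| ≤ 1/ε`. -/
def cutoffModes (ε : ℝ) : Set ℝ := {k : ℝ | ε ≤ |k| ∧ |k| ≤ 1 / ε}

theorem measurableSet_cutoffModes (ε : ℝ) : MeasurableSet (cutoffModes ε) :=
  (measurableSet_le measurable_const continuous_abs.measurable).inter
    (measurableSet_le continuous_abs.measurable measurable_const)

theorem neg_mem_cutoffModes {ε k : ℝ} : -k ∈ cutoffModes ε ↔ k ∈ cutoffModes ε := by
  simp [cutoffModes]

theorem ae_pos_momentumMeasure : ∀ᵐ k ∂momentumMeasure, 0 < k :=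
  (withDensity_absolutelyContinuous _ _).ae_le (ae_restrict_mem measurableSet_Ioi)

theorem cutoffModes_inter_Ioi {ε : ℝ} (hε : 0 < ε) : cutoffModes ε ∩ Ioi 0 = Icc ε (1 / ε) := by
  ext k
  simp only [cutoffModes, mem_inter_iff, mem_ofPred_eq, mem_Ioi, mem_Icc]
  constructor
  · rintro ⟨⟨h1, h2⟩, h3⟩
    rw [abs_of_pos h3] at h1 h2
    exact ⟨h1, h2⟩
  · rintro ⟨h1, h2⟩
    have h3 : 0 < k := hε.trans_le h1
    rw [abs_of_pos h3]
    exact ⟨⟨h1, h2⟩, h3⟩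

theorem momentumMeasure_restrict_cutoffModes {ε : ℝ} (hε : 0 < ε) :
    momentumMeasure.restrict (cutoffModes ε) =
      (volume.restrict (Icc ε (1 / ε))).withDensity fun k => ENNReal.ofReal (1 / (2 * k)) := by
  rw [momentumMeasure, restrict_withDensity (measurableSet_cutoffModes ε),
    Measure.restrict_restrict (measurableSet_cutoffModes ε), cutoffModes_inter_Ioi hε]

theorem isFiniteMeasure_restrict_cutoffModes {ε : ℝ} (hε : 0 < ε) :
    IsFiniteMeasure (momentumMeasure.restrict (cutoffModes ε)) := by
  rw [momentumMeasure_restrict_cutoffModes hε]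
  refine isFiniteMeasure_withDensity ?_
  refine ((setLIntegral_mono' measurableSet_Icc
    (g := fun _ => ENNReal.ofReal (1 / (2 * ε))) fun k hk => ?_).trans_lt ?_).ne
  · exact ENNReal.ofReal_le_ofReal (one_div_le_one_div_of_le (by linarith) (by linarith [hk.1]))
  · rw [setLIntegral_const]
    exact ENNReal.mul_lt_top ENNReal.ofReal_lt_top (by simp)

theorem setIntegral_cutoffModes_sin {ε : ℝ} (hε : 0 < ε) (hε1 : ε ≤ 1) (D : ℝ) :
    ∫ k in cutoffModes ε, Real.sin (k * D) ∂momentumMeasure =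
      (sineIntegral (D / ε) - sineIntegral (ε * D)) / 2 := by
  have hle : ε ≤ 1 / ε := by rw [le_div_iff₀ hε]; nlinarith
  rw [momentumMeasure_restrict_cutoffModes hε,
    integral_withDensity_eq_integral_toReal_smul measurable_momentumDensity
      (Eventually.of_forall fun _ => ENNReal.ofReal_lt_top),
    ← integral_sin_mul_div hε hε1, intervalIntegral.integral_of_le hle, integral_Icc_eq_integral_Ioc]
  refine setIntegral_congr_fun measurableSet_Ioc fun k hk => ?_
  have : 0 < k := hε.trans hk.1
  simp only [smul_eq_mul]
  rw [ENNReal.toReal_ofReal (by positivity)]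

theorem aecover_cutoffModes : AECover momentumMeasure (𝓝[>] 0) cutoffModes where
  ae_eventually_mem := by
    filter_upwards [ae_pos_momentumMeasure] with k hk
    have h1 : ∀ᶠ ε : ℝ in 𝓝[>] 0, ε < k := eventually_nhdsWithin_of_eventually_nhds
      (eventually_lt_nhds hk)
    have h2 : ∀ᶠ ε : ℝ in 𝓝[>] 0, k ≤ ε⁻¹ := tendsto_inv_nhdsGT_zero.eventually_ge_atTop k
    filter_upwards [h1, h2] with ε h1 h2
    simp only [cutoffModes, mem_ofPred_eq, abs_of_pos hk, one_div]
    exact ⟨h1.le, h2⟩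
  measurableSet := measurableSet_cutoffModes

/-! ### The momentum transform -/

theorem norm_cexp_neg_I_mul (k x : ℝ) : ‖Complex.exp (-(Complex.I * (k : ℂ) * (x : ℂ)))‖ = 1 := by
  have : -(Complex.I * (k : ℂ) * (x : ℂ)) = ((-(k * x) : ℝ) : ℂ) * Complex.I := by
    push_cast; ring
  rw [this, Complex.norm_exp_ofReal_mul_I]

theorem continuous_momentumTransform {X : ℝ → ℝ} (hX : Measurable X) {f : ℝ → ℂ}
    (hf : Integrable f) : Continuous (momentumTransform X f) := by
  refine continuous_const.mul (continuous_of_dominated (bound := fun y => ‖f y‖) (fun k => ?_)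
    (fun k => Eventually.of_forall fun y => ?_) hf.norm (Eventually.of_forall fun y => ?_))
  · exact (Measurable.aestronglyMeasurable (by fun_prop)).mul hf.aestronglyMeasurable
  · rw [norm_mul, norm_cexp_neg_I_mul, one_mul]
  · fun_prop

theorem exists_norm_momentumTransform_le (X : ℝ → ℝ) (f : ℝ → ℂ) :
    ∃ M : ℝ, ∀ k, ‖momentumTransform X f k‖ ≤ M := by
  refine ⟨‖(((Real.sqrt (2 * Real.pi))⁻¹ : ℝ) : ℂ)‖ * ∫ y, ‖f y‖, fun k => ?_⟩
  rw [momentumTransform, norm_mul]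
  refine mul_le_mul_of_nonneg_left ((norm_integral_le_integral_norm _).trans (le_of_eq ?_))
    (norm_nonneg _)
  simp_rw [norm_mul, norm_cexp_neg_I_mul, one_mul]

theorem momentumTransform_conj (X : ℝ → ℝ) (f : ℝ → ℂ) (k : ℝ) :
    momentumTransform X (fun y => starRingEnd ℂ (f y)) k =
      starRingEnd ℂ (momentumTransform X f (-k)) := by
  rw [momentumTransform, momentumTransform, map_mul, Complex.conj_ofReal, ← integral_conj]
  congr 2
  ext y
  rw [map_mul, ← Complex.exp_conj]
  simp

theorem momentumTransform_mul_neg (X Z : ℝ → ℝ) (u v : ℝ → ℂ) (k : ℝ) :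
    momentumTransform X u k * momentumTransform Z v (-k) =
      ((2 * Real.pi)⁻¹ : ℝ) * ∫ p : ℝ × ℝ,
        Complex.exp (-(Complex.I * (k : ℂ) * ((X p.1 - Z p.2 : ℝ) : ℂ))) * (u p.1 * v p.2) := by
  have hc : (((Real.sqrt (2 * Real.pi))⁻¹ : ℝ) : ℂ) * (((Real.sqrt (2 * Real.pi))⁻¹ : ℝ) : ℂ) =
      (((2 * Real.pi)⁻¹ : ℝ) : ℂ) := by
    rw [← Complex.ofReal_mul, ← mul_inv, Real.mul_self_sqrt (by positivity)]
  rw [momentumTransform, momentumTransform, mul_mul_mul_comm, hc, ← integral_prod_mul]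
  congr 2
  ext p
  rw [mul_mul_mul_comm, ← Complex.exp_add]
  congr 2
  push_cast
  ring

/-- Antisymmetrizing turns the exponentials into a sine, whose zero at `k = 0` compensates the
singularity of `dk/2k`. -/
theorem momentumTransform_antisymm {X Z : ℝ → ℝ} (hX : Measurable X) (hZ : Measurable Z)
    {u v : ℝ → ℂ} (hu : Integrable u) (hv : Integrable v) (k : ℝ) :
    momentumTransform X u k * momentumTransform Z v (-k) -
      momentumTransform X u (-k) * momentumTransform Z v k =
      ∫ p : ℝ × ℝ, -(Complex.I / Real.pi) *
        ((Real.sin (k * (X p.1 - Z p.2)) : ℂ) * (u p.1 * v p.2)) := by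
  have hw : Integrable (fun p : ℝ × ℝ => u p.1 * v p.2) := hu.mul_prod hv
  have hexp : ∀ k : ℝ, Integrable fun p : ℝ × ℝ =>
      Complex.exp (-(Complex.I * (k : ℂ) * ((X p.1 - Z p.2 : ℝ) : ℂ))) * (u p.1 * v p.2) :=
    fun k => hw.bdd_mul (c := 1) (Measurable.aestronglyMeasurable (by fun_prop))
      (Eventually.of_forall fun p => (norm_cexp_neg_I_mul _ _).le)
  have h := momentumTransform_mul_neg X Z u v (-k)
  rw [neg_neg] at h
  rw [h, momentumTransform_mul_neg, ← mul_sub, ← integral_sub (hexp k) (hexp (-k)),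
    ← integral_const_mul]
  congr 1
  ext p
  have e : ∀ z : ℂ, Complex.exp (-(Complex.I * z)) - Complex.exp (Complex.I * z)
      = -2 * Complex.I * Complex.sin z := by
    intro z
    simp only [Complex.sin, neg_mul, mul_comm Complex.I z]
    linear_combination (Complex.exp (-(z * Complex.I)) - Complex.exp (z * Complex.I)) *
      Complex.I_sq
  have e2 := e ((k * (X p.1 - Z p.2) : ℝ) : ℂ)
  rw [← sub_mul, Complex.ofReal_sin]
  have h1 : -(Complex.I * (k : ℂ) * ((X p.1 - Z p.2 : ℝ) : ℂ)) =
    -(Complex.I * ((k * (X p.1 - Z p.2) : ℝ) : ℂ)) := by push_cast; ring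
  have h2 : -(Complex.I * ((-k : ℝ) : ℂ) * ((X p.1 - Z p.2 : ℝ) : ℂ)) =
    Complex.I * ((k * (X p.1 - Z p.2) : ℝ) : ℂ) := by push_cast; ring
  rw [h1, h2, e2]
  have hpi : (Real.pi : ℂ) ≠ 0 := by exact_mod_cast Real.pi_ne_zero
  push_cast
  field_simp

theorem setIntegral_cutoffModes_antisymm {X Z : ℝ → ℝ} (hX : Measurable X) (hZ : Measurable Z)
    {u v : ℝ → ℂ} (hu : Integrable u) (hv : Integrable v) {ε : ℝ} (hε : 0 < ε) (hε1 : ε ≤ 1) :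
    ∫ k in cutoffModes ε, (momentumTransform X u k * momentumTransform Z v (-k) -
      momentumTransform X u (-k) * momentumTransform Z v k) ∂momentumMeasure =
      -(Complex.I / (2 * Real.pi)) * ∫ p : ℝ × ℝ,
        ((sineIntegral ((X p.1 - Z p.2) / ε) - sineIntegral (ε * (X p.1 - Z p.2)) : ℝ) : ℂ) *
          (u p.1 * v p.2) := by
  have := isFiniteMeasure_restrict_cutoffModes hε
  have hw : Integrable (fun p : ℝ × ℝ => u p.1 * v p.2) := hu.mul_prod hv
  simp_rw [momentumTransform_antisymm hX hZ hu hv]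
  -- Fubini applies because the cutoff momentum measure is finite.
  rw [integral_integral_swap]
  · rw [← integral_const_mul]
    congr 1
    ext p
    rw [integral_const_mul, integral_mul_const, integral_complex_ofReal,
      setIntegral_cutoffModes_sin hε hε1]
    push_cast
    ring
  · refine Integrable.const_mul ?_ _
    refine (hw.comp_snd (momentumMeasure.restrict (cutoffModes ε))).bdd_mul (c := 1)
      (Measurable.aestronglyMeasurable (by fun_prop)) (Eventually.of_forall fun p => ?_)
    rw [Complex.norm_real]
    exact Real.abs_sin_le_one _

theorem measurable_realSign : Measurable Real.sign := by
  unfold Real.sign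
  exact Measurable.ite measurableSet_Iio measurable_const
    (Measurable.ite measurableSet_Ioi measurable_const measurable_const)

theorem tendsto_setIntegral_cutoffModes_antisymm {X Z : ℝ → ℝ} (hX : Measurable X)
    (hZ : Measurable Z) {u v : ℝ → ℂ} (hu : Integrable u) (hv : Integrable v) :
    Tendsto (fun ε => ∫ k in cutoffModes ε,
      (momentumTransform X u k * momentumTransform Z v (-k) -
        momentumTransform X u (-k) * momentumTransform Z v k) ∂momentumMeasure) (𝓝[>] 0)
      (𝓝 (-(Complex.I / (2 * Real.pi)) * ∫ p : ℝ × ℝ,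
        ((sineIntegralLimit * Real.sign (X p.1 - Z p.2) : ℝ) : ℂ) * (u p.1 * v p.2))) := by
  have hw : Integrable (fun p : ℝ × ℝ => u p.1 * v p.2) := hu.mul_prod hv
  have hSi := continuous_sineIntegral.measurable
  refine Tendsto.congr' (f₁ := fun ε => -(Complex.I / (2 * Real.pi)) * ∫ p : ℝ × ℝ,
        ((sineIntegral ((X p.1 - Z p.2) / ε) - sineIntegral (ε * (X p.1 - Z p.2)) : ℝ) : ℂ) *
          (u p.1 * v p.2)) ?_ (Tendsto.const_mul _ ?_)
  · filter_upwards [self_mem_nhdsWithin,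
      eventually_nhdsWithin_of_eventually_nhds (eventually_le_nhds one_pos)] with ε h0 h1
    exact (setIntegral_cutoffModes_antisymm hX hZ hu hv h0 h1).symm
  -- The factor `6` bounds two sine integrals, each of modulus at most `3`.
  · refine tendsto_integral_filter_of_dominated_convergence
      (fun p => 6 * ‖u p.1 * v p.2‖) (Eventually.of_forall fun ε => ?_)
      (Eventually.of_forall fun ε => Eventually.of_forall fun p => ?_) (hw.norm.const_mul 6)
      (Eventually.of_forall fun p => ?_)
    · exact (Measurable.aestronglyMeasurable (by fun_prop)).mul hw.aestronglyMeasurable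
    · rw [norm_mul, Complex.norm_real, Real.norm_eq_abs]
      refine mul_le_mul_of_nonneg_right ((abs_sub _ _).trans ?_) (norm_nonneg _)
      linarith [abs_sineIntegral_le ((X p.1 - Z p.2) / ε),
        abs_sineIntegral_le (ε * (X p.1 - Z p.2))]
    · exact ((Complex.continuous_ofReal.tendsto _).comp
        (tendsto_sineIntegral_div _)).mul_const _

/-! ### The field on the vacuum and on one-particle states -/

theorem smear_vacuum_one (H : ℝ → ℂ) (k : Fin 1 → ℝ) : smear H vacuum 1 k = H (-k 0) := by
  simp [smear, annihilate, create, vacuum]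

theorem smear_vacuum_of_ne_one (H : ℝ → ℂ) {n : ℕ} (hn : n ≠ 1) (k : Fin n → ℝ) :
    smear H vacuum n k = 0 := by
  match n with
  | 0 => simp [smear, annihilate, create, vacuum]
  | 1 => exact absurd rfl hn
  | n + 2 => simp [smear, annihilate, create, vacuum]

theorem normSq_smear_vacuum (H : ℝ → ℂ) :
    normSq (smear H vacuum) = ∫⁻ k, ‖H (-k)‖ₑ ^ 2 ∂momentumMeasure := by
  rw [normSq, tsum_eq_single 1]
  · simp_rw [smear_vacuum_one]
    exact (measurePreserving_funUnique momentumMeasure (Fin 1)).lintegral_comp_emb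
      (MeasurableEquiv.measurableEmbedding _) fun k => ‖H (-k)‖ₑ ^ 2
  · intro n hn
    simp [smear_vacuum_of_ne_one H hn]

theorem smear_smear_vacuum_zero (H H₀ : ℝ → ℂ) (k : Fin 0 → ℝ) :
    smear H (smear H₀ vacuum) 0 k = ∫ q, H q * H₀ (-q) ∂momentumMeasure := by
  rw [smear, Pi.add_apply, Pi.add_apply, annihilate, create]
  simp [smear_vacuum_one]

theorem smear_smear_vacuum_two (H H₀ : ℝ → ℂ) (k : Fin 2 → ℝ) :
    smear H (smear H₀ vacuum) 2 k =
      ((Real.sqrt 2)⁻¹ : ℂ) * (H (-k 0) * H₀ (-k 1) + H (-k 1) * H₀ (-k 0)) := by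
  rw [smear, Pi.add_apply, Pi.add_apply, annihilate, create]
  have h0 : (0 : Fin 2).succAbove 0 = 1 := rfl
  have h1 : (1 : Fin 2).succAbove 0 = 0 := rfl
  simp only [smear_vacuum_of_ne_one H₀ (show 2 + 1 ≠ 1 by norm_num), smear_vacuum_one]
  rw [Fin.sum_univ_two, h0, h1]
  norm_num

theorem smear_smear_vacuum_of_ne (H H₀ : ℝ → ℂ) {n : ℕ} (h0 : n ≠ 0) (h2 : n ≠ 2)
    (k : Fin n → ℝ) : smear H (smear H₀ vacuum) n k = 0 := by
  match n with
  | 0 => exact absurd rfl h0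
  | n + 1 =>
    rw [smear, Pi.add_apply, Pi.add_apply, annihilate, create]
    simp [smear_vacuum_of_ne_one H₀ (show n + 1 + 1 ≠ 1 by omega),
      smear_vacuum_of_ne_one H₀ (show n ≠ 1 by omega)]

/-- Only the zero- and two-particle components survive; `2⁻¹` is the square of the bosonic
normalization `(√2)⁻¹`. -/
theorem normSq_smear_smear_vacuum (H H₀ : ℝ → ℂ) :
    normSq (smear H (smear H₀ vacuum)) =
      ‖∫ q, H q * H₀ (-q) ∂momentumMeasure‖ₑ ^ 2 +
        2⁻¹ * ∫⁻ p : ℝ × ℝ, ‖H (-p.1) * H₀ (-p.2) + H (-p.2) * H₀ (-p.1)‖ₑ ^ 2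
          ∂(momentumMeasure.prod momentumMeasure) := by
  rw [normSq, tsum_eq_sum (s := {0, 2})]
  · rw [Finset.sum_pair (by norm_num)]
    congr 1
    · simp_rw [smear_smear_vacuum_zero]
      simp
    · simp_rw [smear_smear_vacuum_two, enorm_mul, mul_pow]
      rw [lintegral_const_mul' _ _ (by simp)]
      congr 1
      · rw [← Complex.ofReal_inv, ← ofReal_norm, Complex.norm_real,
          ← ENNReal.ofReal_pow (norm_nonneg _), Real.norm_eq_abs, sq_abs, inv_pow,
          Real.sq_sqrt zero_le_two, ENNReal.ofReal_inv_of_pos two_pos, ENNReal.ofReal_ofNat]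
      · exact (measurePreserving_finTwoArrow momentumMeasure).lintegral_comp_emb
          (MeasurableEquiv.measurableEmbedding _)
          fun p : ℝ × ℝ => ‖H (-p.1) * H₀ (-p.2) + H (-p.2) * H₀ (-p.1)‖ₑ ^ 2
  · intro n hn
    simp only [Finset.mem_insert, Finset.mem_singleton, not_or] at hn
    simp [smear_smear_vacuum_of_ne H H₀ hn.1 hn.2]

/-! ### The norm of a symmetrized product of two one-particle functions -/

section Symmetrization

variable {α : Type*} [MeasurableSpace α] {μ : Measure α}

theorem lintegral_enorm_sq_eq {h : α → ℂ} (hh : MemLp h 2 μ) :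
    ∫⁻ x, ‖h x‖ₑ ^ 2 ∂μ = ENNReal.ofReal (∫ x, ‖h x‖ ^ 2 ∂μ) := by
  rw [ofReal_integral_eq_lintegral_ofReal ((memLp_two_iff_integrable_sq_norm hh.1).1 hh)
    (Eventually.of_forall fun _ => by positivity)]
  simp_rw [ENNReal.ofReal_pow (norm_nonneg _), ofReal_norm]

theorem memLp_two_of_lintegral_ne_top {h : α → ℂ} (hm : AEStronglyMeasurable h μ)
    (hh : ∫⁻ x, ‖h x‖ₑ ^ 2 ∂μ ≠ ∞) : MemLp h 2 μ := by
  rw [memLp_two_iff_integrable_sq_norm hm]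
  refine ⟨hm.norm.pow 2, ?_⟩
  rw [hasFiniteIntegral_iff_enorm]
  simpa [enorm_pow] using hh.lt_top

/-- On expanding the square, the two diagonal terms have equal integrals, and the cross term factors
into an inner product times its conjugate. -/
theorem lintegral_enorm_sq_symm [SigmaFinite μ] {h h₀ : α → ℂ} (hh : MemLp h 2 μ)
    (hh₀ : MemLp h₀ 2 μ) :
    ∫⁻ p : α × α, ‖h p.1 * h₀ p.2 + h p.2 * h₀ p.1‖ₑ ^ 2 ∂(μ.prod μ) =
      ENNReal.ofReal (2 * ((∫ x, ‖h x‖ ^ 2 ∂μ) * (∫ x, ‖h₀ x‖ ^ 2 ∂μ) +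
        ‖∫ x, h x * starRingEnd ℂ (h₀ x) ∂μ‖ ^ 2)) := by
  have i1 := (memLp_two_iff_integrable_sq_norm hh.1).1 hh
  have i2 := (memLp_two_iff_integrable_sq_norm hh₀.1).1 hh₀
  have i3 : Integrable (fun x => h x * starRingEnd ℂ (h₀ x)) μ := hh.integrable_mul hh₀.star
  have i4 : Integrable (fun x => h₀ x * starRingEnd ℂ (h x)) μ := hh₀.integrable_mul hh.star
  have e : ∀ p : α × α, ‖h p.1 * h₀ p.2 + h p.2 * h₀ p.1‖ ^ 2 =
      (‖h p.1‖ ^ 2 * ‖h₀ p.2‖ ^ 2 + ‖h₀ p.1‖ ^ 2 * ‖h p.2‖ ^ 2) +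
        2 * ((h p.1 * starRingEnd ℂ (h₀ p.1)) * (h₀ p.2 * starRingEnd ℂ (h p.2))).re := by
    intro p
    simp only [← Complex.normSq_eq_norm_sq]
    rw [Complex.normSq_add, map_mul, map_mul, map_mul]
    have : h p.1 * h₀ p.2 * (starRingEnd ℂ (h p.2) * starRingEnd ℂ (h₀ p.1)) =
      (h p.1 * starRingEnd ℂ (h₀ p.1)) * (h₀ p.2 * starRingEnd ℂ (h p.2)) := by ring
    rw [this]
    ring
  have j1 := i1.mul_prod i2
  have j2 := i2.mul_prod i1
  have j3 := i3.mul_prod i4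
  have j12 : Integrable (fun p : α × α => ‖h p.1‖ ^ 2 * ‖h₀ p.2‖ ^ 2 + ‖h₀ p.1‖ ^ 2 * ‖h p.2‖ ^ 2)
    (μ.prod μ) := j1.add j2
  have j3' : Integrable (fun p : α × α => 2 * ((h p.1 * starRingEnd ℂ (h₀ p.1)) *
    (h₀ p.2 * starRingEnd ℂ (h p.2))).re) (μ.prod μ) := j3.re.const_mul 2
  have hI : Integrable (fun p : α × α => ‖h p.1 * h₀ p.2 + h p.2 * h₀ p.1‖ ^ 2) (μ.prod μ) := by
    simp_rw [e]
    exact j12.add j3'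
  have hv : ∫ p : α × α, ‖h p.1 * h₀ p.2 + h p.2 * h₀ p.1‖ ^ 2 ∂(μ.prod μ) =
      2 * ((∫ x, ‖h x‖ ^ 2 ∂μ) * (∫ x, ‖h₀ x‖ ^ 2 ∂μ) +
        ‖∫ x, h x * starRingEnd ℂ (h₀ x) ∂μ‖ ^ 2) := by
    simp_rw [e]
    have hc : ∫ x, h₀ x * starRingEnd ℂ (h x) ∂μ =
        starRingEnd ℂ (∫ x, h x * starRingEnd ℂ (h₀ x) ∂μ) := by
      rw [← integral_conj]
      congr 1
      ext x
      simp [mul_comm]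
    have hre : ∫ p : α × α, ((h p.1 * starRingEnd ℂ (h₀ p.1)) *
        (h₀ p.2 * starRingEnd ℂ (h p.2))).re ∂(μ.prod μ) =
        ‖∫ x, h x * starRingEnd ℂ (h₀ x) ∂μ‖ ^ 2 := by
      have h1 := integral_re j3
      simp only [RCLike.re_to_complex] at h1
      rw [h1, integral_prod_mul (fun x => h x * starRingEnd ℂ (h₀ x))
        (fun x => h₀ x * starRingEnd ℂ (h x)), hc, Complex.mul_conj, Complex.ofReal_re,
        Complex.normSq_eq_norm_sq]
    rw [integral_add j12 j3', integral_add j1 j2, integral_const_mul, hre,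
      integral_prod_mul (fun x => ‖h x‖ ^ 2) (fun x => ‖h₀ x‖ ^ 2),
      integral_prod_mul (fun x => ‖h₀ x‖ ^ 2) (fun x => ‖h x‖ ^ 2)]
    ring
  rw [← hv, ofReal_integral_eq_lintegral_ofReal hI (Eventually.of_forall fun _ => by positivity)]
  simp_rw [ENNReal.ofReal_pow (norm_nonneg _), ofReal_norm]

/-- Were the integral finite, almost every slice at fixed `y` would be square integrable in `x`. A
slice with `h₀ y ≠ 0` can be solved for `h`, which would then be square integrable. -/
theorem lintegral_enorm_sq_symm_eq_top [SigmaFinite μ] {h h₀ : α → ℂ} (hm : Measurable h)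
    (hm₀ : Measurable h₀) (hh₀ : MemLp h₀ 2 μ) (hne : ∫⁻ x, ‖h₀ x‖ₑ ^ 2 ∂μ ≠ 0)
    (hh : ¬ MemLp h 2 μ) :
    ∫⁻ p : α × α, ‖h p.1 * h₀ p.2 + h p.2 * h₀ p.1‖ₑ ^ 2 ∂(μ.prod μ) = ∞ := by
  by_contra hfin
  have hM : Measurable fun p : α × α => ‖h p.1 * h₀ p.2 + h p.2 * h₀ p.1‖ₑ ^ 2 := by fun_prop
  rw [lintegral_prod_symm _ hM.aemeasurable] at hfin
  have hae := ae_lt_top (Measurable.lintegral_prod_left hM) hfin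
  refine hne ?_
  rw [lintegral_eq_zero_iff (by fun_prop)]
  filter_upwards [hae] with y hy
  by_contra hy0
  have hy0' : h₀ y ≠ 0 := by simpa using hy0
  have h1 : MemLp (fun x => h x * h₀ y + h y * h₀ x) 2 μ :=
    memLp_two_of_lintegral_ne_top (by fun_prop) hy.ne
  have h2 := (h1.sub (hh₀.const_mul (h y))).const_mul (h₀ y)⁻¹
  refine hh (h2.ae_eq (Eventually.of_forall fun x => ?_))
  simp only [Pi.sub_apply, add_sub_cancel_right]
  field_simp

end Symmetrization

/-- Because `H₀` is normalized, the diagonal term is exactly the vacuum norm, and only two overlaps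
remain. -/
theorem normSq_smear_smear_vacuum_of_memLp {H H₀ : ℝ → ℂ}
    (hH : MemLp (fun k => H (-k)) 2 momentumMeasure)
    (hH₀ : MemLp (fun k => H₀ (-k)) 2 momentumMeasure)
    (h1 : ∫ k, ‖H₀ (-k)‖ ^ 2 ∂momentumMeasure = 1) :
    normSq (smear H (smear H₀ vacuum)) = normSq (smear H vacuum) +
      ENNReal.ofReal (‖∫ q, H q * H₀ (-q) ∂momentumMeasure‖ ^ 2 +
        ‖∫ q, H (-q) * starRingEnd ℂ (H₀ (-q)) ∂momentumMeasure‖ ^ 2) := by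
  rw [normSq_smear_smear_vacuum, normSq_smear_vacuum, lintegral_enorm_sq_eq hH,
    lintegral_enorm_sq_symm hH hH₀, h1, ENNReal.ofReal_mul zero_le_two, ENNReal.ofReal_ofNat,
    ← mul_assoc, ENNReal.inv_mul_cancel (by simp) (by simp), one_mul, mul_one,
    ← ofReal_norm, ← ENNReal.ofReal_pow (norm_nonneg _),
    ← ENNReal.ofReal_add (by positivity) (by positivity),
    ← ENNReal.ofReal_add (by positivity) (by positivity)]
  congr 1
  ring

theorem normSq_smear_smear_vacuum_eq_top {H H₀ : ℝ → ℂ} (hm : Measurable H) (hm₀ : Measurable H₀)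
    (hH : ¬ MemLp (fun k => H (-k)) 2 momentumMeasure)
    (hH₀ : MemLp (fun k => H₀ (-k)) 2 momentumMeasure)
    (hne : ∫⁻ k, ‖H₀ (-k)‖ₑ ^ 2 ∂momentumMeasure ≠ 0) :
    normSq (smear H (smear H₀ vacuum)) = ∞ := by
  rw [normSq_smear_smear_vacuum, lintegral_enorm_sq_symm_eq_top (h := fun k => H (-k))
    (h₀ := fun k => H₀ (-k)) (by fun_prop) (by fun_prop) hH₀ hne hH]
  simp

/-! ### The difference of the mean numbers -/

/-- The limit of the integral of `(û(k) v̂(-k) - û(-k) v̂(k)) dk/2k` over the modes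
`ε ≤ k ≤ 1/ε`, where `û` is the momentum transform of `u` in the coordinate `X` and `v̂` is the
Fourier transform of `v`. -/
noncomputable def amplitude (X : ℝ → ℝ) (u v : ℝ → ℂ) : ℂ :=
  -(Complex.I / (2 * Real.pi)) * ∫ p : ℝ × ℝ,
    ((sineIntegralLimit * Real.sign (X p.1 - p.2) : ℝ) : ℂ) * (u p.1 * v p.2)

theorem integrable_conj {g : ℝ → ℂ} (hg : Integrable g) :
    Integrable fun x => starRingEnd ℂ (g x) :=
  hg.mono (Complex.continuous_conj.comp_aestronglyMeasurable hg.1)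
    (Eventually.of_forall fun x => by simp)

variable {X : ℝ → ℝ} {f g : ℝ → ℂ}

/-- For `k > 0` the second antisymmetrized term contains the conjugate of the Fourier transform of
`g` at `-k`, which vanishes. -/
theorem tendsto_setIntegral_cutoffModes_conj (hX : Measurable X) (hf : Integrable f)
    (hg : IsNormalizedWaveFunction g) :
    Tendsto (fun ε => ∫ k in cutoffModes ε, momentumTransform X f k *
      momentumTransform id (fun x => starRingEnd ℂ (g x)) (-k) ∂momentumMeasure) (𝓝[>] 0)
      (𝓝 (amplitude X f fun x => starRingEnd ℂ (g x))) := by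
  refine (tendsto_setIntegral_cutoffModes_antisymm hX measurable_id hf
    (integrable_conj hg.integrable)).congr fun ε => integral_congr_ae ?_
  filter_upwards [ae_restrict_of_ae ae_pos_momentumMeasure] with k hk
  rw [momentumTransform_conj id g k, hg.positive_momentum (-k) (by linarith)]
  simp

/-- Here the first antisymmetrized term vanishes and the second one survives, hence the sign. -/
theorem tendsto_setIntegral_cutoffModes_neg (hX : Measurable X) (hf : Integrable f)
    (hg : IsNormalizedWaveFunction g) :
    Tendsto (fun ε => ∫ k in cutoffModes ε, momentumTransform X f (-k) * starRingEnd ℂ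
      (momentumTransform id (fun x => starRingEnd ℂ (g x)) (-k)) ∂momentumMeasure) (𝓝[>] 0)
      (𝓝 (-amplitude X f g)) := by
  refine (tendsto_setIntegral_cutoffModes_antisymm hX measurable_id hf hg.integrable).neg.congr
    fun ε => ?_
  rw [← integral_neg]
  refine integral_congr_ae ?_
  filter_upwards [ae_restrict_of_ae ae_pos_momentumMeasure] with k hk
  rw [momentumTransform_conj id g, hg.positive_momentum (-k) (by linarith)]
  simp

theorem memLp_indicator_cutoffModes (hX : Measurable X) (hf : Integrable f) {ε : ℝ} (hε : 0 < ε) :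
    MemLp (fun k => (cutoffModes ε).indicator (momentumTransform X f) (-k)) 2
      momentumMeasure := by
  have he : (fun k => (cutoffModes ε).indicator (momentumTransform X f) (-k)) =
      (cutoffModes ε).indicator fun k => momentumTransform X f (-k) := by
    ext k
    by_cases hk : k ∈ cutoffModes ε <;> simp [hk, neg_mem_cutoffModes]
  have := isFiniteMeasure_restrict_cutoffModes hε
  obtain ⟨M, hM⟩ := exists_norm_momentumTransform_le X f
  rw [he, memLp_indicator_iff_restrict (measurableSet_cutoffModes ε)]
  exact MemLp.of_bound ((continuous_momentumTransform hX hf).comp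
    continuous_neg).measurable.aestronglyMeasurable M (Eventually.of_forall fun k => hM _)

/-- The positive and negative momentum parts differ by a finite amount, so that if the latter is
square integrable, so is the former. -/
theorem memLp_momentumTransform (hX : Measurable X) (hf : Integrable f)
    (h : MemLp (fun k => momentumTransform X f (-k)) 2 momentumMeasure) :
    MemLp (momentumTransform X f) 2 momentumMeasure := by
  have hc := continuous_momentumTransform hX hf
  have hc' : Continuous fun k => momentumTransform X f (-k) := hc.comp continuous_neg
  rw [memLp_two_iff_integrable_sq_norm hc.measurable.aestronglyMeasurable]
  have hn := (memLp_two_iff_integrable_sq_norm hc'.measurable.aestronglyMeasurable).1 h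
  -- Pairing `f` with its own conjugate makes the antisymmetrized product the difference of the
  -- squared moduli at `k` and `-k`, so its cutoff integrals converge.
  have ht := Complex.continuous_re.tendsto _ |>.comp
    (tendsto_setIntegral_cutoffModes_antisymm hX hX hf (integrable_conj hf))
  have ht2 := aecover_cutoffModes.integral_tendsto_of_countably_generated hn
  obtain ⟨M, hM⟩ := exists_norm_momentumTransform_le X f
  have hint : ∀ ε : ℝ, IntegrableOn (fun k => ‖momentumTransform X f k‖ ^ 2)
      (cutoffModes ε) momentumMeasure := by
    intro ε
    rcases le_or_gt ε 0 with hε | hε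
    -- The covering criterion asks for every real `ε`. For `ε ≤ 0` one has `1 / ε ≤ 0` (with `1 / 0
    -- = 0`), so no positive mode is left.
    · have h0 : momentumMeasure (cutoffModes ε) = 0 := by
        rw [measure_eq_zero_iff_ae_notMem]
        filter_upwards [ae_pos_momentumMeasure] with k hk0 hk
        have h1 := (abs_pos.2 (ne_of_gt hk0)).trans_le (hk.2.trans (one_div_nonpos.2 hε))
        exact lt_irrefl _ h1
      rw [IntegrableOn, Measure.restrict_eq_zero.2 h0]
      exact integrable_zero_measure
    have := isFiniteMeasure_restrict_cutoffModes hε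
    refine Integrable.of_bound (hc.norm.pow 2).measurable.aestronglyMeasurable (M ^ 2)
      (Eventually.of_forall fun k => ?_)
    rw [norm_pow, norm_norm]
    exact pow_le_pow_left₀ (norm_nonneg _) (hM k) 2
  obtain ⟨c, ht3⟩ : ∃ c, Tendsto (fun ε => ∫ k in cutoffModes ε, ‖momentumTransform X f k‖ ^ 2
      ∂momentumMeasure) (𝓝[>] 0) (𝓝 c) := by
    refine ⟨_, (ht.add ht2).congr' ?_⟩
    filter_upwards [self_mem_nhdsWithin] with ε hε
    have e : ∀ k, momentumTransform X f k *
        momentumTransform X (fun x => starRingEnd ℂ (f x)) (-k) - momentumTransform X f (-k) *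
          momentumTransform X (fun x => starRingEnd ℂ (f x)) k =
        ((‖momentumTransform X f k‖ ^ 2 - ‖momentumTransform X f (-k)‖ ^ 2 : ℝ) : ℂ) := by
      intro k
      rw [momentumTransform_conj, momentumTransform_conj, neg_neg, Complex.mul_conj,
        Complex.mul_conj, Complex.normSq_eq_norm_sq, Complex.normSq_eq_norm_sq]
      push_cast
      rfl
    simp only [Function.comp_apply]
    simp_rw [e]
    rw [integral_complex_ofReal, Complex.ofReal_re, integral_sub (hint ε) hn.integrableOn]
    ring
  refine aecover_cutoffModes.integrable_of_integral_norm_tendsto c hint ?_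
  simpa using ht3

theorem isNumberDifference (hX : Measurable X) (hf : Integrable f)
    (hg : IsNormalizedWaveFunction g) :
    IsNumberDifference X g f
      (‖amplitude X f fun x => starRingEnd ℂ (g x)‖ ^ 2 + ‖amplitude X f g‖ ^ 2) := by
  have hcF := continuous_momentumTransform hX hf
  have hcG : Continuous (momentumTransform id fun x => starRingEnd ℂ (g x)) :=
    continuous_momentumTransform measurable_id (integrable_conj hg.integrable)
  have hnorm : ∀ k, ‖momentumTransform id (fun x => starRingEnd ℂ (g x)) (-k)‖ₑ =
      ‖momentumTransform id g k‖ₑ := by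
    intro k
    rw [momentumTransform_conj, neg_neg, ← ofReal_norm, RCLike.norm_conj, ofReal_norm]
  have hg1 : ∫⁻ k, ‖momentumTransform id (fun x => starRingEnd ℂ (g x)) (-k)‖ₑ ^ 2
      ∂momentumMeasure = 1 := by
    simp_rw [hnorm]
    exact hg.normalized
  have hgL : MemLp (fun k => momentumTransform id (fun x => starRingEnd ℂ (g x)) (-k)) 2
      momentumMeasure :=
    memLp_two_of_lintegral_ne_top (hcG.comp continuous_neg).measurable.aestronglyMeasurable
      (by simp [hg1])
  have hg2 : ∫ k, ‖momentumTransform id (fun x => starRingEnd ℂ (g x)) (-k)‖ ^ 2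
      ∂momentumMeasure = 1 := by
    rw [lintegral_enorm_sq_eq hgL] at hg1
    exact ENNReal.ofReal_eq_one.1 hg1
  have hA := tendsto_setIntegral_cutoffModes_conj hX hf hg
  have hB := tendsto_setIntegral_cutoffModes_neg hX hf hg
  constructor
  · by_cases hL : MemLp (fun k => momentumTransform X f (-k)) 2 momentumMeasure
    -- Both overlaps are now absolutely convergent, so the full integrals are the cutoff limits.
    · have hL' := memLp_momentumTransform hX hf hL
      have iA : _ = ∫ k, momentumTransform X f k *
          momentumTransform id (fun x => starRingEnd ℂ (g x)) (-k) ∂momentumMeasure :=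
        tendsto_nhds_unique hA (aecover_cutoffModes.integral_tendsto_of_countably_generated
        (hL'.integrable_mul hgL))
      have iB : _ = ∫ k, momentumTransform X f (-k) * starRingEnd ℂ
          (momentumTransform id (fun x => starRingEnd ℂ (g x)) (-k)) ∂momentumMeasure :=
        tendsto_nhds_unique hB (aecover_cutoffModes.integral_tendsto_of_countably_generated
        (hL.integrable_mul hgL.star))
      have h := normSq_smear_smear_vacuum_of_memLp hL hgL hg2
      rw [meanNumber, meanNumber, outField, oneParticleState, inField, h, EReal.coe_ennreal_add,
        EReal.coe_ennreal_ofReal, max_eq_left (by positivity)]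
      rw [← iA, ← iB, norm_neg]
    -- Both mean numbers are infinite, and `∞ = ∞ + d` holds for every real `d`.
    · have h := normSq_smear_smear_vacuum_eq_top hcF.measurable hcG.measurable hL hgL
        (by simp [hg1])
      have h0 : normSq (smear (momentumTransform X f) vacuum) = ∞ := by
        rw [normSq_smear_vacuum]
        by_contra hne
        exact hL (memLp_two_of_lintegral_ne_top
          (hcF.comp continuous_neg).measurable.aestronglyMeasurable hne)
      rw [meanNumber, meanNumber, outField, oneParticleState, inField, h, h0, EReal.coe_ennreal_top,
        EReal.top_add_coe]
  · have ht := (hA.norm.pow 2).add (hB.norm.pow 2)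
    rw [norm_neg] at ht
    refine ht.congr' ?_
    filter_upwards [self_mem_nhdsWithin] with ε hε
    have hL := memLp_indicator_cutoffModes hX hf hε
    have h := normSq_smear_smear_vacuum_of_memLp hL hgL hg2
    have hfin : normSq (smear ((cutoffModes ε).indicator (momentumTransform X f)) vacuum) ≠ ∞ := by
      rw [normSq_smear_vacuum, lintegral_enorm_sq_eq hL]
      exact ENNReal.ofReal_ne_top
    have h2 : ∀ V : ℝ → ℂ, ∫ k, (cutoffModes ε).indicator (momentumTransform X f) k * V k
        ∂momentumMeasure = ∫ k in cutoffModes ε, momentumTransform X f k * V k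
        ∂momentumMeasure := by
      intro V
      rw [← integral_indicator (measurableSet_cutoffModes ε)]
      congr 1
      ext k
      by_cases hk : k ∈ cutoffModes ε <;> simp [hk]
    have h3 : ∀ V : ℝ → ℂ, ∫ k, (cutoffModes ε).indicator (momentumTransform X f) (-k) * V k
        ∂momentumMeasure = ∫ k in cutoffModes ε, momentumTransform X f (-k) * V k
        ∂momentumMeasure := by
      intro V
      rw [← integral_indicator (measurableSet_cutoffModes ε)]
      congr 1
      ext k
      by_cases hk : k ∈ cutoffModes ε <;> simp [hk, neg_mem_cutoffModes]
    rw [h2 fun k => momentumTransform id (fun x => starRingEnd ℂ (g x)) (-k),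
      h3 fun k => starRingEnd ℂ (momentumTransform id (fun x => starRingEnd ℂ (g x)) (-k))] at h
    change _ = (normSq (smear ((cutoffModes ε).indicator (momentumTransform X f))
      (smear (momentumTransform id fun x => starRingEnd ℂ (g x)) vacuum))).toReal -
      (normSq (smear ((cutoffModes ε).indicator (momentumTransform X f)) vacuum)).toReal
    rw [h, ENNReal.toReal_add hfin ENNReal.ofReal_ne_top, ENNReal.toReal_ofReal (by positivity)]
    ring

/-! ### Late-time behaviour of the amplitudes -/

/-- The integral is, up to a nonzero factor, the Fourier transform at `0`, which by continuity is
its limit from negative momenta. -/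
theorem IsNormalizedWaveFunction.integral_eq_zero {f : ℝ → ℂ} (hf : IsNormalizedWaveFunction f) :
    ∫ y, f y = 0 := by
  have hc := continuous_momentumTransform measurable_id hf.integrable
  have h0 : momentumTransform id f 0 = 0 := by
    have h1 : Tendsto (momentumTransform id f) (𝓝[<] 0) (𝓝 (momentumTransform id f 0)) :=
      (hc.tendsto 0).mono_left nhdsWithin_le_nhds
    refine tendsto_nhds_unique h1 (tendsto_const_nhds.congr' ?_)
    filter_upwards [self_mem_nhdsWithin] with k hk
    exact (hf.positive_momentum k hk).symm
  rw [momentumTransform, mul_eq_zero] at h0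
  rcases h0 with h0 | h0
  · simp only [Complex.ofReal_eq_zero, inv_eq_zero] at h0
    exact absurd h0 (Real.sqrt_pos.2 (by positivity)).ne'
  · simpa using h0

theorem setIntegral_Ioc_eq_neg (v : ℝ → ℂ) {a : ℝ} (ha : a ≤ 0) :
    ∫ x in Ioc a 0, v x = -∫ x in (0 : ℝ)..a, v x := by
  rw [← intervalIntegral.integral_symm, intervalIntegral.integral_of_le ha]

theorem continuous_primitive_zero {v : ℝ → ℂ} (hv : Integrable v) :
    Continuous fun a : ℝ => ∫ x in (0 : ℝ)..a, v x :=
  intervalIntegral.continuous_primitive (fun _ _ => hv.intervalIntegrable) 0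

theorem norm_setIntegral_Ioc_le {v : ℝ → ℂ} (hv : Integrable v) (a : ℝ) :
    ‖∫ x in Ioc a 0, v x‖ ≤ ∫ x in Iio 0, ‖v x‖ := by
  refine (norm_integral_le_integral_norm _).trans ?_
  rw [← integral_Iic_eq_integral_Iio]
  exact setIntegral_mono_set hv.norm.integrableOn (Eventually.of_forall fun _ => norm_nonneg _)
    (Eventually.of_forall fun x hx => hx.2)

/-- Off `x = a` the sign is `1` minus twice the indicator of `(a, ∞)`. Cutting that half-line at `0`
isolates the only part that depends on `a`. -/
theorem integral_sign_mul {v : ℝ → ℂ} (hv : Integrable v) {a : ℝ} (ha : a ≤ 0) :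
    ∫ x, (Real.sign (a - x) : ℂ) * v x =
      ((∫ x, v x) - 2 * ∫ x in Ioi 0, v x) - 2 * ∫ x in Ioc a 0, v x := by
  have i1 : Integrable ((Ioi (0 : ℝ)).indicator v) := hv.indicator measurableSet_Ioi
  have i2 : Integrable ((Ioc a 0).indicator v) := hv.indicator measurableSet_Ioc
  have i3 : Integrable fun x => v x - 2 * (Ioi (0 : ℝ)).indicator v x := hv.sub (i1.const_mul 2)
  rw [← integral_indicator measurableSet_Ioi, ← integral_indicator measurableSet_Ioc,
    ← integral_const_mul, ← integral_const_mul, ← integral_sub hv (i1.const_mul 2),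
    ← integral_sub i3 (i2.const_mul 2)]
  refine integral_congr_ae ?_
  have hne : ∀ᵐ x : ℝ, x ≠ a := by
    rw [ae_iff]; simp
  filter_upwards [hne] with x hx
  rcases lt_or_gt_of_ne hx with h | h
  · have h1 : x ∉ Ioi (0 : ℝ) := by simp; linarith
    have h2 : x ∉ Ioc a 0 := fun hh => absurd hh.1 (by linarith)
    rw [Real.sign_of_pos (by linarith)]
    simp [h1, h2]
  · rw [Real.sign_of_neg (by linarith)]
    rcases le_or_gt x 0 with h0 | h0
    · have h1 : x ∉ Ioi (0 : ℝ) := by simpa using h0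
      have h2 : x ∈ Ioc a 0 := ⟨h, h0⟩
      simp only [h1, h2, indicator_of_mem, indicator_of_notMem, not_false_eq_true]
      push_cast; ring
    · have h1 : x ∈ Ioi (0 : ℝ) := h0
      have h2 : x ∉ Ioc a 0 := fun hh => absurd hh.2 (by linarith)
      simp only [h1, h2, indicator_of_mem, indicator_of_notMem, not_false_eq_true]
      push_cast; ring

theorem measurable_setIntegral_Ioc {X : ℝ → ℝ} (hX : Measurable X) (hX0 : ∀ y, X y ≤ 0)
    {v : ℝ → ℂ} (hv : Integrable v) :
    Measurable fun y => ∫ x in Ioc (X y) 0, v x := by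
  simp_rw [setIntegral_Ioc_eq_neg v (hX0 _)]
  exact ((continuous_primitive_zero hv).measurable.comp hX).neg

theorem amplitude_eq {X : ℝ → ℝ} (hX : Measurable X) (hX0 : ∀ y, X y ≤ 0)
    {u v : ℝ → ℂ} (hu : Integrable u) (hv : Integrable v) (hu0 : ∫ y, u y = 0) :
    amplitude X u v = (Complex.I * (sineIntegralLimit / Real.pi : ℝ)) *
      ∫ y, u y * ∫ x in Ioc (X y) 0, v x := by
  have hw : Integrable (fun p : ℝ × ℝ => u p.1 * v p.2) := hu.mul_prod hv
  have hs := measurable_realSign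
  have hI : Integrable (fun p : ℝ × ℝ => ((sineIntegralLimit * Real.sign (X p.1 - p.2) : ℝ) : ℂ) *
      (u p.1 * v p.2)) := by
    refine hw.bdd_mul (c := |sineIntegralLimit|) (Measurable.aestronglyMeasurable (by fun_prop))
      (Eventually.of_forall fun p => ?_)
    rw [Complex.norm_real, Real.norm_eq_abs, abs_mul]
    refine mul_le_of_le_one_right (abs_nonneg _) ?_
    rcases Real.sign_apply_eq (X p.1 - p.2) with h | h | h <;> simp [h]
  have hK : Integrable fun y => u y * ∫ x in Ioc (X y) 0, v x :=
    hu.mul_bdd (c := ∫ x in Iio 0, ‖v x‖)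
      (measurable_setIntegral_Ioc hX hX0 hv).aestronglyMeasurable
      (Eventually.of_forall fun y => norm_setIntegral_Ioc_le hv _)
  rw [amplitude, Measure.volume_eq_prod, integral_prod _ hI]
  have hin : ∀ y, ∫ x, ((sineIntegralLimit * Real.sign (X y - x) : ℝ) : ℂ) * (u y * v x) =
      ((sineIntegralLimit : ℂ) * ((∫ x, v x) - 2 * ∫ x in Ioi 0, v x)) * u y -
        (2 * (sineIntegralLimit : ℂ)) * (u y * ∫ x in Ioc (X y) 0, v x) := by
    intro y
    have e : ∀ x, ((sineIntegralLimit * Real.sign (X y - x) : ℝ) : ℂ) * (u y * v x) =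
        ((sineIntegralLimit : ℂ) * u y) * ((Real.sign (X y - x) : ℂ) * v x) := by
      intro x; push_cast; ring
    simp_rw [e]
    rw [integral_const_mul, integral_sign_mul hv (hX0 y)]
    ring
  simp_rw [hin]
  -- The contribution independent of `X y` is a multiple of `∫ u = 0`.
  rw [integral_sub (hu.const_mul _) (hK.const_mul _), integral_const_mul, integral_const_mul, hu0]
  have hpi : (Real.pi : ℂ) ≠ 0 := by exact_mod_cast Real.pi_ne_zero
  push_cast
  field_simp
  ring

/-- The prefactor of `amplitude_eq` has modulus at most `3/π < 1`. -/
theorem norm_amplitude_translate_le {X : ℝ → ℝ} (hX : Measurable X) (hX0 : ∀ y, X y ≤ 0)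
    {u v : ℝ → ℂ} (hu : Integrable u) (hv : Integrable v)
    (hu0 : ∫ y, u y = 0) (y₀ : ℝ) :
    ‖amplitude X (translate y₀ u) v‖ ≤ ‖∫ y, u y * ∫ x in Ioc (X (y + y₀)) 0, v x‖ := by
  have hu0' : ∫ y, translate y₀ u y = 0 := by
    rw [← hu0]; exact integral_sub_right_eq_self u y₀
  have hu' : Integrable (translate y₀ u) := hu.comp_sub_right y₀
  rw [amplitude_eq hX hX0 hu' hv hu0', norm_mul,
    ← integral_sub_right_eq_self (fun y => u y * ∫ x in Ioc (X (y + y₀)) 0, v x) y₀]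
  simp only [sub_add_cancel]
  refine mul_le_of_le_one_left (norm_nonneg _) ?_
  rw [norm_mul, Complex.norm_I, one_mul, Complex.norm_real, Real.norm_eq_abs, abs_div,
    abs_of_pos Real.pi_pos, div_le_one Real.pi_pos]
  linarith [abs_sineIntegralLimit_le, Real.pi_gt_three]

theorem tendsto_amplitude_translate {X : ℝ → ℝ} (hX : Measurable X) (hX0 : ∀ y, X y ≤ 0)
    (hlim : Tendsto X atTop (𝓝 0)) {u v : ℝ → ℂ}
    (hu : Integrable u) (hv : Integrable v) (hu0 : ∫ y, u y = 0) :
    Tendsto (fun y₀ => amplitude X (translate y₀ u) v) atTop (𝓝 0) := by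
  refine squeeze_zero_norm (norm_amplitude_translate_le hX hX0 hu hv hu0) ?_
  suffices h : Tendsto (fun y₀ => ∫ y, u y * ∫ x in Ioc (X (y + y₀)) 0, v x) atTop (𝓝 0) by
    simpa using h.norm
  rw [← integral_zero ℝ ℂ]
  refine tendsto_integral_filter_of_dominated_convergence
    (fun y => ‖u y‖ * ∫ x in Iio 0, ‖v x‖) (Eventually.of_forall fun y₀ => ?_)
    (Eventually.of_forall fun y₀ => Eventually.of_forall fun y => ?_) (hu.norm.mul_const _)
    (Eventually.of_forall fun y => ?_)
  · exact hu.aestronglyMeasurable.mul ((measurable_setIntegral_Ioc hX hX0 hv).comp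
      (measurable_add_const y₀)).aestronglyMeasurable
  · rw [norm_mul]
    exact mul_le_mul_of_nonneg_left (norm_setIntegral_Ioc_le hv _) (norm_nonneg _)
  · simp_rw [setIntegral_Ioc_eq_neg v (hX0 _)]
    have h := (((continuous_primitive_zero hv).tendsto 0).comp
      (hlim.comp (tendsto_atTop_add_const_left atTop y tendsto_id))).neg.const_mul (u y)
    simpa using h

/-- The distant past of `u` sees the whole of `v` on the negative axis, the rest of `u` only its
values close to the horizon. -/
theorem norm_amplitude_translate_le_add {X : ℝ → ℝ} (hX : Measurable X) (hX0 : ∀ y, X y ≤ 0)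
    (hXexp : ∀ y, -Real.exp (-y) ≤ X y) {u v : ℝ → ℂ}
    (hu : Integrable u) (hv : Integrable v) (hu0 : ∫ y, u y = 0) {R y₀ δ M : ℝ}
    (hM : 0 ≤ M) (hδ : ∀ x ∈ Ioo (-δ) 0, ‖v x‖ ≤ M) (hR : Real.exp (R - y₀) ≤ δ) :
    ‖amplitude X (translate y₀ u) v‖ ≤
      (∫ x in Iio 0, ‖v x‖) * (∫ y in Iic (-R), ‖u y‖) +
        M * Real.exp (R - y₀) * ∫ y, ‖u y‖ := by
  refine (norm_amplitude_translate_le hX hX0 hu hv hu0 y₀).trans ?_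
  have hi : Integrable ((Iic (-R)).indicator fun y => ‖u y‖) :=
    hu.norm.indicator measurableSet_Iic
  rw [← integral_indicator measurableSet_Iic, ← integral_const_mul, ← integral_const_mul,
    ← integral_add (hi.const_mul _) (hu.norm.const_mul _)]
  refine norm_integral_le_of_norm_le ((hi.const_mul _).add (hu.norm.const_mul _))
    (Eventually.of_forall fun y => ?_)
  have hN : 0 ≤ ∫ x in Iio 0, ‖v x‖ := integral_nonneg fun _ => norm_nonneg _
  rw [norm_mul]
  rcases le_or_gt y (-R) with hy | hy
  · rw [indicator_of_mem (show y ∈ Iic (-R) from hy)]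
    have h := mul_le_mul_of_nonneg_left (norm_setIntegral_Ioc_le hv (X (y + y₀)))
      (norm_nonneg (u y))
    have h2 : 0 ≤ M * Real.exp (R - y₀) * ‖u y‖ := by positivity
    linarith
  · rw [indicator_of_notMem (by simpa using hy), mul_zero, zero_add, mul_comm]
    refine mul_le_mul_of_nonneg_right ?_ (norm_nonneg _)
    have h1 : Real.exp (-(y + y₀)) ≤ Real.exp (R - y₀) := Real.exp_le_exp.2 (by linarith)
    have h2 := hXexp (y + y₀)
    -- The endpoint `0` is dropped because `v` is bounded only strictly to the left of the horizon.
    rw [integral_Ioc_eq_integral_Ioo]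
    refine (norm_setIntegral_le_of_norm_le_const (by simp) fun x hx =>
      hδ x ⟨by linarith [hx.1], hx.2⟩).trans ?_
    rw [measureReal_def, Real.volume_Ioo, ENNReal.toReal_ofReal (by linarith [hX0 (y + y₀)])]
    exact mul_le_mul_of_nonneg_left (by linarith) hM

theorem setIntegral_Iic_norm_le {f : ℝ → ℂ} {α C L R : ℝ} (hα : 0 < α)
    (hf : Integrable f) (hdecay : ∀ᵐ y : ℝ, y ≤ -L → ‖f y‖ ≤ C / |y| ^ (1 + α)) (hR : 0 < R)
    (hLR : L ≤ R) : ∫ y in Iic (-R), ‖f y‖ ≤ C / (α * R ^ α) := by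
  have hint : IntegrableOn (fun t : ℝ => C * t ^ (-(1 + α))) (Ioi R) :=
    (integrableOn_Ioi_rpow_of_lt (by linarith) hR).const_mul C
  have hval : ∫ t in Ioi R, C * t ^ (-(1 + α)) = C / (α * R ^ α) := by
    rw [integral_const_mul, integral_Ioi_rpow_of_lt (by linarith) hR]
    have h1 : -(1 + α) + 1 = -α := by ring
    rw [h1, Real.rpow_neg hR.le]
    have := Real.rpow_pos_of_pos hR α
    field_simp
  rw [← hval, ← integral_comp_neg_Ioi R fun y => ‖f y‖]
  refine setIntegral_mono_ae_restrict hf.norm.comp_neg.integrableOn hint ?_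
  have hd : ∀ᵐ t : ℝ, -t ≤ -L → ‖f (-t)‖ ≤ C / |(-t)| ^ (1 + α) :=
    (Measure.measurePreserving_neg (volume : Measure ℝ)).quasiMeasurePreserving.ae hdecay
  filter_upwards [ae_restrict_of_ae hd, ae_restrict_mem measurableSet_Ioi] with t h1 h2
  have h2' : R < t := h2
  have h0 : 0 < t := hR.trans h2'
  refine (h1 (by linarith)).trans (le_of_eq ?_)
  rw [abs_neg, abs_of_pos h0, Real.rpow_neg h0.le, div_eq_mul_inv]

/-- With the splitting point `R = y₀/2 + L`, the past of `f` gives the power-law term, while the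
rest is at most a constant times `exp (-R)` and eventually falls below a third of that term. The
total `4/3` is small enough that `2 * (4/3)^2 ≤ 4`. -/
theorem eventually_norm_amplitude_translate_le {X : ℝ → ℝ} (hX : Measurable X)
    (hX0 : ∀ y, X y ≤ 0) (hXexp : ∀ y, -Real.exp (-y) ≤ X y) {f v : ℝ → ℂ} {α C L : ℝ}
    (hf : Integrable f) (hf0 : ∫ y, f y = 0) (hv : Integrable v) {v₀ : ℂ}
    (hlim : Tendsto v (𝓝[<] 0) (𝓝 v₀)) (hα : 0 < α) (hC : 0 < C)
    (hdecay : ∀ᵐ y : ℝ, y ≤ -L → ‖f y‖ ≤ C / |y| ^ (1 + α)) :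
    ∀ᶠ y₀ : ℝ in atTop, ‖amplitude X (translate y₀ f) v‖ ≤
      4 / 3 * ((∫ x in Iio 0, ‖v x‖) * (C / (α * (y₀ / 2 + L) ^ α))) := by
  set N := ∫ x in Iio 0, ‖v x‖ with hN
  have hN0 : 0 ≤ N := integral_nonneg fun _ => norm_nonneg _
  rcases hN0.eq_or_lt' with hNz | hNpos
  -- If `v` vanishes almost everywhere on the negative axis, the power-law term is zero and absorbs
  -- nothing, but the amplitude vanishes as well.
  · refine Eventually.of_forall fun y₀ => ?_
    refine (norm_amplitude_translate_le hX hX0 hf hv hf0 y₀).trans ?_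
    have hK : ∀ a : ℝ, ∫ x in Ioc a 0, v x = 0 := fun a => by
      rw [← norm_le_zero_iff]
      exact (norm_setIntegral_Ioc_le hv a).trans hNz.le
    simp [hK, hNz]
  obtain ⟨δ, hδ, hδM⟩ : ∃ δ > 0, ∀ x ∈ Ioo (-δ) 0, ‖v x‖ ≤ ‖v₀‖ + 1 := by
    have h := hlim.norm.eventually (eventually_le_nhds (lt_add_one ‖v₀‖))
    obtain ⟨l, hl, hsub⟩ := mem_nhdsLT_iff_exists_Ioo_subset.1 h
    have hl' : l < 0 := hl
    exact ⟨-l, by linarith, fun x hx => hsub (by simpa using hx)⟩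
  set B := (‖v₀‖ + 1) * Real.exp (2 * L) * ∫ y, ‖f y‖ with hB
  have hs : Tendsto (fun y₀ : ℝ => y₀ / 2 + L) atTop atTop :=
    tendsto_atTop_add_const_right _ _ (tendsto_id.atTop_div_const two_pos)
  have hexp : Tendsto (fun y₀ : ℝ => Real.exp (y₀ / 2 + L - y₀)) atTop (𝓝 0) := by
    refine Real.tendsto_exp_atBot.comp ?_
    have : Tendsto (fun y₀ : ℝ => L - y₀ / 2) atTop atBot :=
      tendsto_atBot_add_const_left _ L
        (tendsto_neg_atTop_atBot.comp (tendsto_id.atTop_div_const two_pos))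
    exact this.congr fun y₀ => by ring
  have hpow : Tendsto (fun y₀ : ℝ => B * ((y₀ / 2 + L) ^ α * Real.exp (-1 * (y₀ / 2 + L)))) atTop
      (𝓝 (B * 0)) :=
    ((tendsto_rpow_mul_exp_neg_mul_atTop_nhds_zero α 1 one_pos).comp hs).const_mul B
  rw [mul_zero] at hpow
  have hpos : 0 < N * C / (3 * α) := by positivity
  filter_upwards [hexp.eventually (eventually_le_nhds hδ), hpow.eventually
    (eventually_le_nhds hpos), hs.eventually_gt_atTop 0, eventually_ge_atTop 0] with y₀ h1 h2 h3 h4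
  have hM0 : 0 ≤ ‖v₀‖ + 1 := by positivity
  refine (norm_amplitude_translate_le_add hX hX0 hXexp hf hv hf0 hM0 hδM h1).trans ?_
  have htail := mul_le_mul_of_nonneg_left
    (setIntegral_Iic_norm_le hα hf hdecay h3 (by linarith)) hN0
  have hsα := Real.rpow_pos_of_pos h3 α
  have hnear : (‖v₀‖ + 1) * Real.exp (y₀ / 2 + L - y₀) * ∫ y, ‖f y‖ ≤
      1 / 3 * (N * (C / (α * (y₀ / 2 + L) ^ α))) := by
    have e1 : (‖v₀‖ + 1) * Real.exp (y₀ / 2 + L - y₀) * ∫ y, ‖f y‖ =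
        B * Real.exp (-1 * (y₀ / 2 + L)) := by
      have : y₀ / 2 + L - y₀ = 2 * L + -1 * (y₀ / 2 + L) := by ring
      rw [this, Real.exp_add, hB]
      ring
    have e2 : 1 / 3 * (N * (C / (α * (y₀ / 2 + L) ^ α))) =
        N * C / (3 * α) / (y₀ / 2 + L) ^ α := by
      field_simp
    rw [e1, e2, le_div_iff₀ hsα]
    linarith
  linarith

theorem exists_isNumberDifference {X : ℝ → ℝ} (hX : Measurable X)
    (hX0 : ∀ y, X y ≤ 0) (hXexp : ∀ y, -Real.exp (-y) ≤ X y) {f g : ℝ → ℂ}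
    (hf : IsNormalizedWaveFunction f) (hg : IsNormalizedWaveFunction g) {α C L : ℝ}
    (hα : 0 < α) (hC : 0 < C)
    (hdecay : ∀ᵐ y : ℝ, y ≤ -L → ‖f y‖ ≤ C / |y| ^ (1 + α)) :
    ∃ d : ℝ → ℝ,
      (∀ y₀ : ℝ, IsNumberDifference X g (translate y₀ f) (d y₀)) ∧
      (∀ g₀ : ℂ, Tendsto g (𝓝[<] 0) (𝓝 g₀) →
        ∀ᶠ y₀ : ℝ in atTop,
          |d y₀| ≤ (∫ x in Iio 0, ‖g x‖) ^ 2 * (4 * C ^ 2 / (α ^ 2 * (y₀ / 2 + L) ^ (2 * α))) +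
            Real.exp (2 * L - y₀) * (∫ y, ‖f y‖) ^ 2 * ‖g₀‖ ^ 2) ∧
      Tendsto d atTop (𝓝 0) := by
  have hf0 := hf.integral_eq_zero
  have hgc := integrable_conj hg.integrable
  refine ⟨fun y₀ => ‖amplitude X (translate y₀ f) fun x => starRingEnd ℂ (g x)‖ ^ 2 +
    ‖amplitude X (translate y₀ f) g‖ ^ 2, fun y₀ => isNumberDifference hX
      (hf.integrable.comp_sub_right y₀) hg, fun g₀ hg₀ => ?_, ?_⟩
  · have h1 := eventually_norm_amplitude_translate_le hX hX0 hXexp hf.integrable hf0 hg.integrable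
      hg₀ hα hC hdecay
    have h2 := eventually_norm_amplitude_translate_le hX hX0 hXexp hf.integrable hf0 hgc
      ((Complex.continuous_conj.tendsto g₀).comp hg₀) hα hC hdecay
    simp only [RCLike.norm_conj] at h2
    have hs : Tendsto (fun y₀ : ℝ => y₀ / 2 + L) atTop atTop :=
      tendsto_atTop_add_const_right _ _ (tendsto_id.atTop_div_const two_pos)
    filter_upwards [h1, h2, hs.eventually_gt_atTop 0] with y₀ h1 h2 h3
    have q1 := pow_le_pow_left₀ (norm_nonneg _) h1 2
    have q2 := pow_le_pow_left₀ (norm_nonneg _) h2 2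
    have e : (∫ x in Iio 0, ‖g x‖) ^ 2 * (4 * C ^ 2 / (α ^ 2 * (y₀ / 2 + L) ^ (2 * α))) =
        4 * ((∫ x in Iio 0, ‖g x‖) * (C / (α * (y₀ / 2 + L) ^ α))) ^ 2 := by
      rw [mul_comm 2 α, Real.rpow_mul h3.le, Real.rpow_ofNat]
      ring
    have p1 : 0 ≤ Real.exp (2 * L - y₀) * (∫ y, ‖f y‖) ^ 2 * ‖g₀‖ ^ 2 := by positivity
    have p2 : 0 ≤ ((∫ x in Iio 0, ‖g x‖) * (C / (α * (y₀ / 2 + L) ^ α))) ^ 2 := sq_nonneg _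
    rw [mul_pow] at q1 q2
    -- The two squares add up to at most `32/9` of the squared power-law term, below the allowed
    -- `4`; the exponential term of the bound enters only through its nonnegativity.
    rw [abs_of_nonneg (by positivity), e]
    linarith
  · have hlim : Tendsto X atTop (𝓝 0) := by
      refine tendsto_of_tendsto_of_tendsto_of_le_of_le ?_ tendsto_const_nhds hXexp hX0
      simpa using (Real.tendsto_exp_atBot.comp tendsto_neg_atTop_atBot).neg
    have h1 := tendsto_amplitude_translate hX hX0 hlim hf.integrable hgc hf0
    have h2 := tendsto_amplitude_translate hX hX0 hlim hf.integrable hg.integrable hf0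
    simpa using (h1.norm.pow 2).add (h2.norm.pow 2)

end BlackHole

/-! ### The two black hole models -/

theorem mainTheorem7 (X : ℝ → ℝ)
    (hX : X = BlackHole.relativisticCoord ∨ X = BlackHole.cghsCoord)
    (f g : ℝ → ℂ)
    (hf : BlackHole.IsNormalizedWaveFunction f) (hg : BlackHole.IsNormalizedWaveFunction g)
    (α C L : ℝ) (hα : 0 < α) (hC : 0 < C) (hL : 0 ≤ L)
    (hdecay : ∀ᵐ y : ℝ, y ≤ -L → ‖f y‖ ≤ C / |y| ^ (1 + α)) :
    ∃ d : ℝ → ℝ,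
      (∀ y₀ : ℝ, BlackHole.IsNumberDifference X g (BlackHole.translate y₀ f) (d y₀)) ∧
      (∀ g₀ : ℂ, Tendsto g (𝓝[<] 0) (𝓝 g₀) →
        ∀ᶠ y₀ : ℝ in atTop,
          |d y₀| ≤ (∫ x in Iio 0, ‖g x‖) ^ 2 * (4 * C ^ 2 / (α ^ 2 * (y₀ / 2 + L) ^ (2 * α))) +
            Real.exp (2 * L - y₀) * (∫ y, ‖f y‖) ^ 2 * ‖g₀‖ ^ 2) ∧
      Tendsto d atTop (𝓝 0) := by
  -- Nothing else about the models matters: they approach the horizon from below, at least as fast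
  -- as the relativistic coordinate. For CGHS this is `log (1 + t) ≤ t`.
  have h : Measurable X ∧ (∀ y, X y ≤ 0) ∧ ∀ y, -Real.exp (-y) ≤ X y := by
    rcases hX with rfl | rfl
    · refine ⟨?_, fun y => ?_, fun y => le_rfl⟩
      · unfold BlackHole.relativisticCoord
        fun_prop
      · exact neg_nonpos.2 (Real.exp_pos _).le
    · refine ⟨?_, fun y => ?_, fun y => ?_⟩
      · unfold BlackHole.cghsCoord
        fun_prop
      · exact neg_nonpos.2 (Real.log_nonneg (by linarith [Real.exp_pos (-y)]))
      · refine neg_le_neg ((Real.log_le_sub_one_of_pos ?_).trans (by linarith))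
        linarith [Real.exp_pos (-y)]
  exact BlackHole.exists_isNumberDifference h.1 h.2.1 h.2.2 hf hg hα hC hdecay
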